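/- Let $n \ge 1$ and let $A$ be a $2n\times 2n$ real (symmetric) positive definite matrix. Let $J=\begin{bmatrix} O & I\\ -I & O\end{bmatrix}$, and call a real $2n\times 2n$ matrix $M$ symplectic if $M^TJM=J$. The symplectic eigenvalues of $A$ are the positive numbers $d_1(A)\le d_2(A)\le\cdots\le d_n(A)$ such that, with $D=\operatorname{diag}(d_1(A),\dots,d_n(A))$, there is a symplectic matrix $M$ with $M^TAM=\begin{bmatrix} D & O\\ O & D\end{bmatrix}$; they exist and are uniquely determined by $A$, and likewise for the positive definite matrix $A^t$, $t\ge 0$. They have the following properties. (i) If $0\le t\le 1$, then for all $1\le k\le n$, $$\prod_{j=1}^k d_j(A^t)\ \ge\ \prod_{j=1}^k d_j(A)^t .$$ (ii) If $t\ge 1$, then for all $1\le k\le n$, $$\prod_{j=1}^k d_j(A^t)\ \le\ \prod_{j=1}^k d_j(A)^t .$$ -/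

import Mathlib

open scoped MatrixOrder

/-- `IsSymplecticSpectrum A d` says that `d 0 ≤ d 1 ≤ ⋯ ≤ d (n - 1)` are positive reals for which
some real symplectic matrix `M` satisfies `Mᵀ A M = diag (D, D)`, with `D = diag (d)`.

Mathlib's `Matrix.symplecticGroup` is `{M | M * J * Mᵀ = J}` with `J = [[0, -1], [1, 0]]`; by
`SymplecticGroup.mem_iff'` this is the same as `Mᵀ * J * M = J`, and `J` may be replaced by `-J`. -/
def IsSymplecticSpectrum {n : ℕ} (A : Matrix (Fin n ⊕ Fin n) (Fin n ⊕ Fin n) ℝ)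
    (d : Fin n → ℝ) : Prop :=
  Monotone d ∧ (∀ j, 0 < d j) ∧
    ∃ M ∈ Matrix.symplecticGroup (Fin n) ℝ,
      M.transpose * A * M =
        Matrix.fromBlocks (Matrix.diagonal d) 0 0 (Matrix.diagonal d)

/-- The symplectic eigenvalues of a real positive definite matrix, in increasing order: the
`d` with `IsSymplecticSpectrum A d` (an arbitrary value if there is none). -/
noncomputable def symplecticEigenvalues {n : ℕ}
    (A : Matrix (Fin n ⊕ Fin n) (Fin n ⊕ Fin n) ℝ) : Fin n → ℝ :=
  Classical.epsilon (IsSymplecticSpectrum A)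

/-!
The `d j` are read off from the skew-symmetric matrix `S_t = A ^ (-t/2) J A ^ (-t/2)`: if `d` is a
symplectic spectrum of `A ^ t`, then `S_t` is orthogonally congruent to `diag (d⁻¹, d⁻¹) J`
(`IsSymplecticSpectrum.exists_orthogonal`), so its singular values are the `(d j)⁻¹`, each twice.
Conversely, the orthogonal normal form of the skew-symmetric matrix `A ^ (-1/2) J A ^ (-1/2)`
produces a symplectic spectrum of `A`, which is Williamson's theorem
(`Matrix.PosDef.exists_isSymplecticSpectrum`).

For the inequality with `0 ≤ t ≤ 1`, let the `2k` columns of `X` be orthonormal and span the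
singular subspace of the largest singular values of `S_t`. The entire function
`F z = det (Xᴴ A ^ (-z/2) J A ^ (-z/2) X)` has `|F t| = ∏_{j < k} d_j(A ^ t)⁻²`. On the lines
`Re z = 0` and `Re z = 1` the factors `A ^ (-i y/2)` are unitary and may be absorbed into the two
copies of `X`; there `|F|` is at most `1`, respectively `∏_{j < k} d_j(A)⁻²`, because the
determinant of a compression of a matrix to orthonormal frames is at most the product of its
largest singular values (`Matrix.norm_det_conjTranspose_mul_diagonal_mul_le`). Hadamard's
three-lines theorem then gives `∏ d_j(A ^ t)⁻² ≤ (∏ d_j(A)⁻²) ^ t`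
(`Matrix.norm_det_diagonal_rpow_le`, `IsSymplecticSpectrum.prod_rpow_le`).

The inequality is proved for arbitrary symplectic spectra of `A` and `A ^ t`, so the case `t = 1`
shows that the spectrum is unique. The case `t ≥ 1` follows by applying exponent `t⁻¹` to `A ^ t`.
-/

/-! ### Determinants of compressions to orthonormal frames -/

section DetInequalities

open scoped ComplexOrder
open Matrix

variable {ι κ : Type*} [Fintype ι] [DecidableEq ι] [Fintype κ] [DecidableEq κ]

theorem Matrix.PosSemidef.one_le_det_one_add {P : Matrix κ κ ℂ} (hP : P.PosSemidef) :
    1 ≤ (1 + P).det := by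
  have h : (1 + P).det = ∏ i, ((1 + hP.1.eigenvalues i : ℝ) : ℂ) := by
    conv_lhs => rw [hP.1.spectral_theorem, ← map_one (Unitary.conjStarAlgAut ℂ _
      hP.1.eigenvectorUnitary), ← map_add, Unitary.conjStarAlgAut_apply, det_mul_right_comm]
    have hU : (hP.1.eigenvectorUnitary : Matrix κ κ ℂ) *
        star (hP.1.eigenvectorUnitary : Matrix κ κ ℂ) = 1 :=
      Unitary.mul_star_self_of_mem hP.1.eigenvectorUnitary.2
    rw [hU, one_mul, ← diagonal_one, diagonal_add, det_diagonal]
    simp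
  rw [h]
  have : (1 : ℝ) ≤ ∏ i, (1 + hP.1.eigenvalues i) :=
    Finset.one_le_prod (fun i => by simpa using hP.eigenvalues_nonneg i)
  exact_mod_cast this

/-- The determinant is monotone on positive semidefinite matrices. -/
theorem Matrix.PosSemidef.det_le_det_add {A P : Matrix κ κ ℂ} (hA : A.PosSemidef)
    (hP : P.PosSemidef) : A.det ≤ (A + P).det := by
  by_cases h0 : A.det = 0
  · rw [h0]; exact (hA.add hP).det_nonneg
  obtain ⟨C, rfl⟩ := CStarAlgebra.nonneg_iff_eq_star_mul_self.mp hA.nonneg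
  have hC : IsUnit C.det := by
    rw [isUnit_iff_ne_zero]; intro h; simp [h] at h0
  have key : star C * C + P = Cᴴ * (1 + (C⁻¹)ᴴ * P * C⁻¹) * C := by
    have h1 : Cᴴ * (C⁻¹)ᴴ = 1 := by rw [← conjTranspose_mul, nonsing_inv_mul _ hC]; simp
    have h2 : C⁻¹ * C = 1 := nonsing_inv_mul _ hC
    have : Cᴴ * (1 + (C⁻¹)ᴴ * P * C⁻¹) * C = Cᴴ * C + (Cᴴ * (C⁻¹)ᴴ) * P * (C⁻¹ * C) := by
      noncomm_ring
    rw [this, h1, h2]; simp [star_eq_conjTranspose]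
  have h1 := (hP.conjTranspose_mul_mul_same C⁻¹).one_le_det_one_add
  rw [key, det_mul_right_comm, det_mul (Cᴴ * C), ← star_eq_conjTranspose]
  exact le_mul_of_one_le_right hA.det_nonneg h1

theorem Matrix.posSemidef_one_sub_mul_conjTranspose {Z : Matrix ι κ ℂ} (hZ : Zᴴ * Z = 1) :
    (1 - Z * Zᴴ).PosSemidef := by
  have h : 1 - Z * Zᴴ = (1 - Z * Zᴴ)ᴴ * (1 - Z * Zᴴ) := by
    have : (Z * Zᴴ) * (Z * Zᴴ) = Z * (Zᴴ * Z) * Zᴴ := by simp only [Matrix.mul_assoc]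
    rw [hZ, Matrix.mul_one] at this
    simp [sub_mul, mul_sub, this]
  rw [h]
  exact posSemidef_conjTranspose_mul_self _

/-- The compression of a nonnegative diagonal matrix to an orthonormal frame `Z` has determinant at
most the product of the largest diagonal entries: `e` lists the positions of these entries, and `c`
separates them from the remaining ones. -/
theorem Matrix.det_conjTranspose_mul_diagonal_mul_le {Z : Matrix ι κ ℂ} (hZ : Zᴴ * Z = 1)
    {h : ι → ℝ} (h0 : ∀ i, 0 ≤ h i) {c : ℝ} (hc : 0 < c) {e : κ → ι}
    (he : Function.Injective e) (hin : ∀ j, c ≤ h (e j))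
    (hout : ∀ i, i ∉ Set.range e → h i ≤ c) :
    (Zᴴ * diagonal (fun i => (h i : ℂ)) * Z).det ≤ ∏ j, (h (e j) : ℂ) := by
  classical
  let k : ι → ℝ := fun i => if i ∈ Set.range e then h i / c - 1 else 0
  have hk0 : ∀ i, 0 ≤ k i := by
    intro i
    by_cases hi : i ∈ Set.range e
    · obtain ⟨j, rfl⟩ := hi
      simp [k, one_le_div hc, hin j]
    · simp only [k, if_neg hi, le_refl]
  have hhk : ∀ i, h i ≤ c * (1 + k i) := by
    intro i
    by_cases hi : i ∈ Set.range e
    · simp only [k, hi, if_true]; field_simp; simp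
    · simpa only [k, if_neg hi, add_zero, mul_one] using hout i hi
  let s : Matrix ι ι ℂ := diagonal (fun i => ((√(k i) : ℝ) : ℂ))
  have hs : s * s = diagonal (fun i => (k i : ℂ)) := by
    simp only [s, diagonal_mul_diagonal]
    congr 1; ext i
    exact_mod_cast Real.mul_self_sqrt (hk0 i)
  have hsH : sᴴ = s := by
    simp only [s, diagonal_conjTranspose]
    congr 1; ext i; simp
  -- Replace `diagonal h` by the larger matrix `c (1 + diagonal k)`, with `k` supported on `e`.
  have step1 : (Zᴴ * diagonal (fun i => (h i : ℂ)) * Z).det ≤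
      ((c : ℂ) • (1 + (Zᴴ * s) * (s * Z))).det := by
    have hA : (Zᴴ * diagonal (fun i => (h i : ℂ)) * Z).PosSemidef :=
      (PosSemidef.diagonal (fun i => by simpa using h0 i)).conjTranspose_mul_mul_same Z
    have hP : (Zᴴ * diagonal (fun i => ((c * (1 + k i) - h i : ℝ) : ℂ)) * Z).PosSemidef :=
      (PosSemidef.diagonal (fun i => by
        simpa only [Pi.zero_apply, Complex.zero_le_real, sub_nonneg] using
          hhk i)).conjTranspose_mul_mul_same Z
    convert hA.det_le_det_add hP using 2
    rw [← Matrix.add_mul, ← Matrix.mul_add, diagonal_add]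
    have : diagonal (fun i => (h i : ℂ) + ((c * (1 + k i) - h i : ℝ) : ℂ)) =
        (c : ℂ) • (1 + s * s) := by
      rw [hs, ← diagonal_one, diagonal_add, ← diagonal_smul]
      congr 1; ext i; simp
    rw [this, Matrix.mul_smul, Matrix.smul_mul, Matrix.mul_add, Matrix.add_mul, Matrix.mul_one,
      hZ]
    simp only [Matrix.mul_assoc]
  -- After `det (1 + M N) = det (1 + N M)`, use `Z * Zᴴ ≤ 1`.
  have step2 : (1 + (Zᴴ * s) * (s * Z)).det ≤ (1 + diagonal (fun i => (k i : ℂ))).det := by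
    rw [det_one_add_mul_comm]
    have hA : (1 + (s * Z) * (Zᴴ * s)).PosSemidef := by
      refine PosSemidef.one.add ?_
      have : Zᴴ * s = (s * Z)ᴴ := by rw [conjTranspose_mul, hsH]
      rw [this]; exact posSemidef_self_mul_conjTranspose _
    have hP : (s * (1 - Z * Zᴴ) * s).PosSemidef := by
      simpa only [hsH] using
        (posSemidef_one_sub_mul_conjTranspose hZ).conjTranspose_mul_mul_same s
    convert hA.det_le_det_add hP using 2
    rw [← hs, Matrix.mul_sub, Matrix.sub_mul]
    simp only [Matrix.mul_assoc, Matrix.mul_one]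
    abel
  rw [det_smul] at step1
  refine step1.trans ((mul_le_mul_of_nonneg_left step2 ?_).trans_eq ?_)
  · exact_mod_cast pow_nonneg hc.le _
  · rw [← diagonal_one, diagonal_add, det_diagonal]
    have h1 : ∏ i, (1 + (k i : ℂ)) = ∏ i ∈ Finset.univ.image e, (1 + (k i : ℂ)) := by
      refine (Finset.prod_subset (Finset.subset_univ _) fun i _ hi => ?_).symm
      have : i ∉ Set.range e := by simpa using hi
      simp only [k, if_neg this, Complex.ofReal_zero, add_zero]
    rw [h1, Finset.prod_image he.injOn, ← Finset.card_univ, ← Finset.prod_const,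
      ← Finset.prod_mul_distrib]
    refine Finset.prod_congr rfl fun j _ => ?_
    have hc' : (c : ℂ) ≠ 0 := by exact_mod_cast hc.ne'
    simp only [k, Set.mem_range_self, if_true]
    push_cast; field_simp; ring

/-- The two-frame version of `Matrix.det_conjTranspose_mul_diagonal_mul_le`. It reduces to one frame
and the squared entries, since `Y * Yᴴ ≤ 1`. -/
theorem Matrix.norm_det_conjTranspose_mul_diagonal_mul_le {Y Z : Matrix ι κ ℂ} (hY : Yᴴ * Y = 1)
    (hZ : Zᴴ * Z = 1) {h : ι → ℝ} (h0 : ∀ i, 0 ≤ h i) {c : ℝ} (hc : 0 < c) {e : κ → ι}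
    (he : Function.Injective e) (hin : ∀ j, c ≤ h (e j))
    (hout : ∀ i, i ∉ Set.range e → h i ≤ c) :
    ‖(Yᴴ * diagonal (fun i => (h i : ℂ)) * Z).det‖ ≤ ∏ j, h (e j) := by
  set H : Matrix ι ι ℂ := diagonal (fun i => (h i : ℂ)) with hH
  have hHH : Hᴴ = H := by
    simp only [hH, diagonal_conjTranspose]
    congr 1; ext i; simp
  have hHsq : H * H = diagonal (fun i => ((h i ^ 2 : ℝ) : ℂ)) := by
    simp only [hH, diagonal_mul_diagonal]
    congr 1; ext i; push_cast; ring
  have h1 : ((Yᴴ * H * Z)ᴴ * (Yᴴ * H * Z)).det ≤ (Zᴴ * (H * H) * Z).det := by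
    have hP := (posSemidef_one_sub_mul_conjTranspose hY).conjTranspose_mul_mul_same (H * Z)
    convert (posSemidef_conjTranspose_mul_self (Yᴴ * H * Z)).det_le_det_add hP using 2
    simp only [conjTranspose_mul, conjTranspose_conjTranspose, hHH, Matrix.mul_sub,
      Matrix.sub_mul, Matrix.mul_one, Matrix.mul_assoc]
    abel
  rw [hHsq] at h1
  have hcsq : 0 < c ^ 2 := by positivity
  have h2 := h1.trans (det_conjTranspose_mul_diagonal_mul_le hZ (h := fun i => h i ^ 2)
    (fun i => sq_nonneg _) hcsq he (fun j => pow_le_pow_left₀ hc.le (hin j) 2)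
    (fun i hi => pow_le_pow_left₀ (h0 i) (hout i hi) 2))
  rw [det_mul, det_conjTranspose, RCLike.star_def, ← Complex.normSq_eq_conj_mul_self,
    Complex.normSq_eq_norm_sq, ← Complex.ofReal_prod, Complex.real_le_real,
    Finset.prod_pow] at h2
  exact (pow_le_pow_iff_left₀ (norm_nonneg _) (Finset.prod_nonneg fun _ _ => h0 _)
    two_ne_zero).mp h2

end DetInequalities

/-! ### Interpolation by the three-lines theorem -/

section ThreeLines

open Matrix Complex

variable {ι κ : Type*} [Fintype ι] [DecidableEq ι] [Fintype κ] [DecidableEq κ]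

theorem Matrix.norm_det_conjTranspose_mul_unitary_mul_le_one {Y Z : Matrix ι κ ℂ}
    {K : Matrix ι ι ℂ} (hY : Yᴴ * Y = 1) (hZ : Zᴴ * Z = 1) (hK : Kᴴ * K = 1) {e : κ → ι}
    (he : Function.Injective e) : ‖(Yᴴ * K * Z).det‖ ≤ 1 := by
  have hKZ : (K * Z)ᴴ * (K * Z) = 1 := by
    rw [conjTranspose_mul, Matrix.mul_assoc, ← Matrix.mul_assoc Kᴴ, hK, Matrix.one_mul, hZ]
  simpa [Matrix.mul_assoc] using norm_det_conjTranspose_mul_diagonal_mul_le hY hKZ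
    (h := fun _ => 1) (fun _ => zero_le_one) one_pos he (fun _ => le_rfl) (fun _ _ => le_rfl)

/-- Interpolation between exponents `0` and `1`: a bound `p`, uniform over orthonormal frames, for
the minors of `diag b * K * diag b` with `K` unitary gives the bound `p ^ t` for
`diag (b ^ t) * K * diag (b ^ t)`. -/
theorem Matrix.norm_det_diagonal_rpow_le {K : Matrix ι ι ℂ} (hK : Kᴴ * K = 1) {b : ι → ℝ}
    (hb : ∀ i, 0 < b i) {e : κ → ι} (he : Function.Injective e) {p : ℝ}
    (hp : ∀ Y Z : Matrix ι κ ℂ, Yᴴ * Y = 1 → Zᴴ * Z = 1 →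
      ‖(Yᴴ * (diagonal (fun i => (b i : ℂ)) * K * diagonal (fun i => (b i : ℂ))) * Z).det‖ ≤ p)
    {X : Matrix ι κ ℂ} (hX : Xᴴ * X = 1) {t : ℝ} (ht0 : 0 ≤ t) (ht1 : t ≤ 1) :
    ‖(Xᴴ * (diagonal (fun i => ((b i ^ t : ℝ) : ℂ)) * K *
      diagonal (fun i => ((b i ^ t : ℝ) : ℂ))) * X).det‖ ≤ p ^ t := by
  let G : (ι → ℂ) → ℂ := fun w => (Xᴴ * (diagonal w * K * diagonal w) * X).det
  let w : ℂ → ι → ℂ := fun z i => (b i : ℂ) ^ z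
  have hG : Continuous G := by fun_prop
  have hGd : Differentiable ℂ (fun z => G (w z)) := by
    have hw : ∀ i, Differentiable ℂ (fun z : ℂ => w z i) := fun i =>
      differentiable_id.const_cpow (Or.inl (by exact_mod_cast (hb i).ne'))
    have hent : ∀ i j, Differentiable ℂ
        (fun z => (Xᴴ * (diagonal (w z) * K * diagonal (w z)) * X) i j) := by
      intro i j
      simp only [Matrix.mul_apply, diagonal_apply]
      refine Differentiable.fun_sum fun _ _ => Differentiable.mul (Differentiable.fun_sum fun _ _ =>
        Differentiable.mul (by fun_prop) (Differentiable.fun_sum fun _ _ => Differentiable.mul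
          (Differentiable.fun_sum fun _ _ => Differentiable.mul ?_ (by fun_prop)) ?_))
          (by fun_prop) <;>
      · split_ifs
        · exact hw _
        · fun_prop
    simp only [G, det_apply]
    refine Differentiable.fun_sum fun σ _ => Differentiable.fun_const_smul
      (Differentiable.fun_finsetProd fun i _ => hent _ _) _
  -- Multiplying `X` by a diagonal unitary keeps its columns orthonormal.
  have huX : ∀ u : ι → ℂ, (∀ i, ‖u i‖ = 1) → (diagonal u * X)ᴴ * (diagonal u * X) = 1 := by
    intro u hu
    have : (diagonal u)ᴴ * diagonal u = (1 : Matrix ι ι ℂ) := by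
      rw [diagonal_conjTranspose, diagonal_mul_diagonal, ← diagonal_one]
      congr 1; ext i
      simp [← Complex.normSq_eq_conj_mul_self, Complex.normSq_eq_norm_sq, hu i]
    rw [conjTranspose_mul, Matrix.mul_assoc, ← Matrix.mul_assoc _ _ X, this, Matrix.one_mul, hX]
  have hstar : ∀ u : ι → ℂ, (diagonal (star u) * X)ᴴ = Xᴴ * diagonal u := by
    intro u; rw [conjTranspose_mul, diagonal_conjTranspose, star_star]
  have hnorm : ∀ (z : ℂ) i, ‖w z i‖ = b i ^ z.re := fun z i =>
    norm_cpow_eq_rpow_re_of_pos (hb i) z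
  -- `w` maps the closed strip into a compact set, on which the continuous function `G` is bounded.
  have hB : BddAbove ((norm ∘ fun z => G (w z)) '' HadamardThreeLines.verticalClosedStrip 0 1) := by
    have hc : IsCompact (Set.univ.pi fun i => Metric.closedBall (0 : ℂ) (max 1 (b i))) :=
      isCompact_univ_pi fun i => isCompact_closedBall _ _
    refine (hc.bddAbove_image (f := norm ∘ G) hG.norm.continuousOn).mono ?_
    rintro _ ⟨z, hz, rfl⟩
    refine ⟨w z, fun i _ => ?_, rfl⟩
    rw [mem_closedBall_zero_iff, hnorm]
    have hz' : 0 ≤ z.re ∧ z.re ≤ 1 := hz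
    rcases le_total (b i) 1 with h | h
    · exact (Real.rpow_le_one (hb i).le h hz'.1).trans (le_max_left _ _)
    · refine le_trans ?_ (le_max_right _ _)
      simpa using Real.rpow_le_rpow_of_exponent_le h hz'.2
  have h0 : ∀ z ∈ re ⁻¹' {0}, ‖G (w z)‖ ≤ 1 := by
    intro z hz
    have hu : ∀ i, ‖w z i‖ = 1 := fun i => by rw [hnorm, show z.re = 0 from hz, Real.rpow_zero]
    have := norm_det_conjTranspose_mul_unitary_mul_le_one (huX (star (w z)) (by simpa using hu))
      (huX _ hu) hK he
    rw [hstar] at this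
    simpa only [G, Matrix.mul_assoc] using this
  have h1 : ∀ z ∈ re ⁻¹' {1}, ‖G (w z)‖ ≤ p := by
    intro z hz
    have hu : ∀ i, ‖w (z - 1) i‖ = 1 := fun i => by
      rw [hnorm, sub_re, show z.re = 1 from hz, one_re, sub_self, Real.rpow_zero]
    have hw1 : diagonal (w z) = diagonal (w (z - 1)) * diagonal (fun i => (b i : ℂ)) := by
      rw [diagonal_mul_diagonal]
      congr 1; ext i
      have : (b i : ℂ) ≠ 0 := by exact_mod_cast (hb i).ne'
      simp only [w]
      rw [cpow_sub _ _ this, cpow_one, div_mul_cancel₀ _ this]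
    have hw2 : diagonal (w z) = diagonal (fun i => (b i : ℂ)) * diagonal (w (z - 1)) := by
      rw [hw1, diagonal_mul_diagonal, diagonal_mul_diagonal]
      congr 1; ext i; ring
    have := hp _ _ (huX (star (w (z - 1))) (by simpa using hu)) (huX _ hu)
    rw [hstar] at this
    have heq : G (w z) = (Xᴴ * (diagonal (w z) * K * diagonal (w z)) * X).det := rfl
    rw [heq]
    nth_rewrite 1 [hw1]
    rw [hw2]
    simpa only [Matrix.mul_assoc] using this
  have := HadamardThreeLines.norm_le_interp_of_mem_verticalClosedStrip₀₁' (fun z => G (w z))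
    (z := (t : ℂ)) ⟨by simpa using ht0, by simpa using ht1⟩ hGd.diffContOnCl hB h0 h1
  rw [Real.one_rpow, one_mul, ofReal_re] at this
  have hwt : w t = fun i => ((b i ^ t : ℝ) : ℂ) := by
    ext i; simp only [w]; rw [ofReal_cpow (hb i).le]
  simpa only [G, hwt] using this

end ThreeLines

/-! ### Symplectic spectra and powers -/

section SymplecticSpectrum

open Matrix

theorem Matrix.PosDef.exists_orthogonal_rpow_eq {ι : Type*} [Fintype ι] [DecidableEq ι]
    {A : Matrix ι ι ℝ} (hA : A.PosDef) :
    ∃ (Q : Matrix ι ι ℝ) (a : ι → ℝ), Qᵀ * Q = 1 ∧ (∀ i, 0 < a i) ∧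
      ∀ t : ℝ, A ^ t = Q * diagonal (fun i => a i ^ t) * Qᵀ := by
  refine ⟨hA.1.eigenvectorUnitary, hA.1.eigenvalues, ?_, hA.eigenvalues_pos, fun t => ?_⟩
  · simpa [star_eq_conjTranspose] using
      Unitary.star_mul_self_of_mem hA.1.eigenvectorUnitary.2
  · rw [CFC.rpow_eq_cfc_real hA.posSemidef.nonneg, hA.1.cfc_eq, IsHermitian.cfc,
      Unitary.conjStarAlgAut_apply]
    rfl

theorem Matrix.PosDef.rpow {ι : Type*} [Fintype ι] [DecidableEq ι]
    {A : Matrix ι ι ℝ} (hA : A.PosDef) (t : ℝ) : (A ^ t).PosDef := by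
  rw [← isStrictlyPositive_iff_posDef] at hA ⊢
  exact IsStrictlyPositive.rpow A t hA

variable {n : ℕ}

/-- The diagonal matrix `diag (d, d)`. -/
def doubleDiagonal (d : Fin n → ℝ) : Matrix (Fin n ⊕ Fin n) (Fin n ⊕ Fin n) ℝ :=
  diagonal (Sum.elim d d)

theorem fromBlocks_diagonal_eq (d : Fin n → ℝ) :
    fromBlocks (diagonal d) 0 0 (diagonal d) = doubleDiagonal d := by
  simp [doubleDiagonal]

theorem doubleDiagonal_mul (d d' : Fin n → ℝ) :
    doubleDiagonal d * doubleDiagonal d' = doubleDiagonal (fun j => d j * d' j) := by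
  rw [doubleDiagonal, doubleDiagonal, diagonal_mul_diagonal, doubleDiagonal]
  congr 1; ext (i | i) <;> rfl

theorem doubleDiagonal_one : doubleDiagonal (fun _ : Fin n => (1 : ℝ)) = 1 := by
  rw [doubleDiagonal, ← diagonal_one]
  congr 1; ext (i | i) <;> rfl

theorem transpose_doubleDiagonal (d : Fin n → ℝ) : (doubleDiagonal d)ᵀ = doubleDiagonal d :=
  diagonal_transpose _

theorem doubleDiagonal_mul_J (d : Fin n → ℝ) :
    doubleDiagonal d * J (Fin n) ℝ = J (Fin n) ℝ * doubleDiagonal d := by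
  rw [← fromBlocks_diagonal_eq, J, fromBlocks_multiply, fromBlocks_multiply]
  simp

/-- If `B` plays the role of `A ^ (-1/2)`, then the skew-symmetric matrix `B J B` is orthogonally
congruent to `diag (d⁻¹, d⁻¹) J`: its singular values are the `(d j)⁻¹`, each taken twice. -/
theorem IsSymplecticSpectrum.exists_orthogonal {A B : Matrix (Fin n ⊕ Fin n) (Fin n ⊕ Fin n) ℝ}
    {d : Fin n → ℝ} (h : IsSymplecticSpectrum A d) (hB : Bᵀ = B) (hBA : B * B * A = 1) :
    ∃ R : Matrix (Fin n ⊕ Fin n) (Fin n ⊕ Fin n) ℝ, Rᵀ * R = 1 ∧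
      B * J (Fin n) ℝ * B = R * (doubleDiagonal (fun j => (d j)⁻¹) * J (Fin n) ℝ) * Rᵀ := by
  obtain ⟨-, hd, M, hM, hMA⟩ := h
  rw [fromBlocks_diagonal_eq] at hMA
  have hMu : IsUnit M.det := SymplecticGroup.symplectic_det hM
  have hMM : M⁻¹ * M = 1 := nonsing_inv_mul _ hMu
  have hMM' : M * M⁻¹ = 1 := mul_nonsing_inv _ hMu
  have hTT : Mᵀ * M⁻¹ᵀ = 1 := by rw [← transpose_mul, hMM, transpose_one]
  have hJ : M⁻¹ᵀ * J (Fin n) ℝ * M⁻¹ = J (Fin n) ℝ := by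
    have h1 := SymplecticGroup.mem_iff'.mp hM
    have hTT' : M⁻¹ᵀ * Mᵀ = 1 := by rw [← transpose_mul, hMM', transpose_one]
    calc M⁻¹ᵀ * J (Fin n) ℝ * M⁻¹ = M⁻¹ᵀ * (Mᵀ * J (Fin n) ℝ * M) * M⁻¹ := by rw [h1]
      _ = (M⁻¹ᵀ * Mᵀ) * J (Fin n) ℝ * (M * M⁻¹) := by simp only [Matrix.mul_assoc]
      _ = _ := by rw [hTT', hMM', Matrix.one_mul, Matrix.mul_one]
  -- `R = B M⁻ᵀ diag (√d, √d)`
  let r : Fin n → ℝ := fun j => √(d j)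
  have hrr : ∀ j, r j * r j = d j := fun j => Real.mul_self_sqrt (hd j).le
  have hr : ∀ j, r j ≠ 0 := fun j => (Real.sqrt_pos.mpr (hd j)).ne'
  have hinv : M⁻¹ * (B * B) * M⁻¹ᵀ = doubleDiagonal (fun j => (d j)⁻¹) := by
    have h1 : (M⁻¹ * (B * B) * M⁻¹ᵀ) * doubleDiagonal d = 1 := by
      rw [← hMA]
      calc _ = M⁻¹ * (B * B) * (M⁻¹ᵀ * Mᵀ) * A * M := by simp only [Matrix.mul_assoc]
        _ = M⁻¹ * (B * B * A) * M := by
          rw [← transpose_mul, hMM', transpose_one]; simp only [Matrix.mul_assoc, Matrix.one_mul]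
        _ = 1 := by rw [hBA, Matrix.mul_one, hMM]
    have h2 : doubleDiagonal d * doubleDiagonal (fun j => (d j)⁻¹) = 1 := by
      rw [doubleDiagonal_mul, ← doubleDiagonal_one]
      congr 1; ext j; exact mul_inv_cancel₀ (hd j).ne'
    exact left_inv_eq_right_inv h1 h2
  refine ⟨B * M⁻¹ᵀ * doubleDiagonal r, ?_, ?_⟩
  · rw [transpose_mul, transpose_mul, transpose_transpose, transpose_doubleDiagonal, hB]
    calc _ = doubleDiagonal r * (M⁻¹ * (B * B) * M⁻¹ᵀ) * doubleDiagonal r := by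
          simp only [Matrix.mul_assoc]
      _ = 1 := by
        rw [hinv, doubleDiagonal_mul, doubleDiagonal_mul, ← doubleDiagonal_one]
        congr 1; ext j
        rw [← hrr j]; field_simp [hr j]
  · rw [transpose_mul, transpose_mul, transpose_transpose, transpose_doubleDiagonal, hB]
    have h1 : doubleDiagonal r * (doubleDiagonal (fun j => (d j)⁻¹) * J (Fin n) ℝ) *
        doubleDiagonal r = J (Fin n) ℝ := by
      rw [Matrix.mul_assoc, Matrix.mul_assoc, ← doubleDiagonal_mul_J, ← Matrix.mul_assoc,
        ← Matrix.mul_assoc, doubleDiagonal_mul, doubleDiagonal_mul]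
      have : (fun j => r j * (d j)⁻¹ * r j) = fun _ => (1 : ℝ) := by
        ext j; rw [← hrr j]; field_simp [hr j]
      rw [this, doubleDiagonal_one, Matrix.one_mul]
    calc B * J (Fin n) ℝ * B = B * (M⁻¹ᵀ * J (Fin n) ℝ * M⁻¹) * B := by rw [hJ]
      _ = B * M⁻¹ᵀ * (doubleDiagonal r * (doubleDiagonal (fun j => (d j)⁻¹) * J (Fin n) ℝ) *
        doubleDiagonal r) * M⁻¹ * B := by rw [h1]; simp only [Matrix.mul_assoc]
      _ = _ := by simp only [Matrix.mul_assoc]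

theorem doubleDiagonal_mul_J_submatrix {k : ℕ} (hk : k ≤ n) (d : Fin n → ℝ) :
    (doubleDiagonal d * J (Fin n) ℝ).submatrix (Sum.map (Fin.castLE hk) (Fin.castLE hk))
      (Sum.map (Fin.castLE hk) (Fin.castLE hk)) =
    doubleDiagonal (fun j => d (Fin.castLE hk j)) * J (Fin k) ℝ := by
  ext i j
  rcases i with i | i <;> rcases j with j | j <;>
    simp [doubleDiagonal, diagonal_mul, J, one_apply]

theorem det_doubleDiagonal_mul_J (d : Fin n → ℝ) :
    (doubleDiagonal d * J (Fin n) ℝ).det = (∏ j, d j) ^ 2 := by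
  rw [det_mul, SymplecticGroup.det_eq_one (SymplecticGroup.J_mem _ _), mul_one, doubleDiagonal,
    det_diagonal, Fintype.prod_sum_type, sq]
  rfl

/-- The partial products of the symplectic eigenvalues of `A ^ t` dominate the `t`-th powers of
those of `A`, for any choice of symplectic spectra. -/
theorem IsSymplecticSpectrum.prod_rpow_le {A : Matrix (Fin n ⊕ Fin n) (Fin n ⊕ Fin n) ℝ}
    (hA : A.PosDef) {d d' : Fin n → ℝ} (h : IsSymplecticSpectrum A d) {t : ℝ} (ht0 : 0 ≤ t)
    (ht1 : t ≤ 1) (h' : IsSymplecticSpectrum (A ^ t) d') {k : ℕ} (hk : k ≤ n) :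
    ∏ j : Fin k, d (Fin.castLE hk j) ^ t ≤ ∏ j : Fin k, d' (Fin.castLE hk j) := by
  rcases Nat.eq_zero_or_pos k with rfl | hk0
  · simp
  obtain ⟨Q, a, hQ, ha, hAt⟩ := hA.exists_orthogonal_rpow_eq
  let b : Fin n ⊕ Fin n → ℝ := fun i => a i ^ (-(1 / 2) : ℝ)
  have hb : ∀ i, 0 < b i := fun i => Real.rpow_pos_of_pos (ha i) _
  -- `B s = A ^ (-s / 2)`
  let B : ℝ → Matrix (Fin n ⊕ Fin n) (Fin n ⊕ Fin n) ℝ := fun s =>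
    Q * diagonal (fun i => b i ^ s) * Qᵀ
  have hBT : ∀ s, (B s)ᵀ = B s := fun s => by
    simp [B, transpose_mul, Matrix.mul_assoc]
  have hQ' : Q * Qᵀ = 1 := mul_eq_one_comm.mp hQ
  have hBA : ∀ s, B s * B s * A ^ s = 1 := fun s => by
    rw [hAt]
    have h1 : B s * B s * (Q * diagonal (fun i => a i ^ s) * Qᵀ) =
        Q * (diagonal (fun i => b i ^ s) * ((Qᵀ * Q) * diagonal (fun i => b i ^ s)) *
          ((Qᵀ * Q) * diagonal (fun i => a i ^ s))) * Qᵀ := by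
      simp only [B, Matrix.mul_assoc]
    rw [h1, hQ, Matrix.one_mul, Matrix.one_mul, diagonal_mul_diagonal, diagonal_mul_diagonal]
    have h2 : (fun i => b i ^ s * b i ^ s * a i ^ s) = fun _ => (1 : ℝ) := by
      ext i
      simp only [b]
      rw [← Real.rpow_mul (ha i).le, ← Real.rpow_add (ha i), ← Real.rpow_add (ha i)]
      convert Real.rpow_zero (a i) using 2
      ring
    rw [h2, diagonal_one, Matrix.mul_one, hQ']
  have hA1 : A ^ (1 : ℝ) = A := CFC.rpow_one A hA.posSemidef.nonneg
  obtain ⟨R, hR, hRB⟩ := h.exists_orthogonal (hBT 1) (by simpa only [hA1] using hBA 1)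
  obtain ⟨R', hR', hRB'⟩ := h'.exists_orthogonal (hBT t) (hBA t)
  let e : Fin k ⊕ Fin k → Fin n ⊕ Fin n := Sum.map (Fin.castLE hk) (Fin.castLE hk)
  have he : Function.Injective e :=
    (Fin.castLE_injective hk).sumMap (Fin.castLE_injective hk)
  let φ := Complex.ofRealHom
  have hφ : ∀ {ι κ : Type} (N : Matrix ι κ ℝ), (N.map φ)ᴴ = Nᵀ.map φ := fun N => by
    ext i j; simp [φ]
  let K : Matrix (Fin n ⊕ Fin n) (Fin n ⊕ Fin n) ℝ := Qᵀ * J (Fin n) ℝ * Q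
  have hJJ : (J (Fin n) ℝ)ᵀ * J (Fin n) ℝ = 1 := by
    rw [J_transpose, Matrix.neg_mul, J_squared, neg_neg]
  have hKK : Kᵀ * K = 1 := by
    calc Kᵀ * K = Qᵀ * ((J (Fin n) ℝ)ᵀ * ((Q * Qᵀ) * J (Fin n) ℝ)) * Q := by
          simp only [K, transpose_mul, transpose_transpose, Matrix.mul_assoc]
      _ = 1 := by rw [hQ', Matrix.one_mul, hJJ, Matrix.mul_one, hQ]
  have hKu : (K.map φ)ᴴ * K.map φ = 1 := by
    rw [hφ, ← Matrix.map_mul, hKK, Matrix.map_one _ (map_zero φ) (map_one φ)]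
  have hBK : ∀ s : ℝ, diagonal (fun i => b i ^ s) * K * diagonal (fun i => b i ^ s) =
      Qᵀ * (B s * J (Fin n) ℝ * B s) * Q := fun s => by
    calc _ = (Qᵀ * Q) * diagonal (fun i => b i ^ s) * Qᵀ * J (Fin n) ℝ * Q *
          diagonal (fun i => b i ^ s) * (Qᵀ * Q) := by
          rw [hQ, Matrix.one_mul, Matrix.mul_one]; simp only [K, Matrix.mul_assoc]
      _ = _ := by simp only [B, Matrix.mul_assoc]
  have hdiag : ∀ s : ℝ, diagonal (fun i => ((b i ^ s : ℝ) : ℂ)) =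
      (diagonal (fun i => b i ^ s)).map φ := fun s => by
    rw [diagonal_map (map_zero φ)]; rfl
  -- The singular values of `B 1 * J * B 1`; the largest `2 k` of them sit at the positions `e`.
  let g : Fin n ⊕ Fin n → ℝ := Sum.elim (fun j => (d j)⁻¹) (fun j => (d j)⁻¹)
  have hd := h.2.1
  have hmono := h.1
  have hg0 : ∀ i, 0 ≤ g i := by rintro (i | i) <;> exact (inv_pos.mpr (hd i)).le
  let l : Fin n := ⟨k - 1, by omega⟩
  have hin : ∀ j, (d l)⁻¹ ≤ g (e j) := by
    have : ∀ j : Fin k, (d l)⁻¹ ≤ (d (Fin.castLE hk j))⁻¹ := fun j =>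
      inv_anti₀ (hd _) (hmono (Fin.mk_le_mk.mpr (by have := j.2; simp; omega)))
    rintro (j | j) <;> exact this j
  have hout : ∀ i, i ∉ Set.range e → g i ≤ (d l)⁻¹ := by
    have key : ∀ i : Fin n, (∀ j : Fin k, Fin.castLE hk j ≠ i) → (d i)⁻¹ ≤ (d l)⁻¹ := by
      intro i hi
      refine inv_anti₀ (hd _) (hmono ?_)
      by_contra hlt
      have hlt' : (i : ℕ) < k - 1 := by simpa [l, Fin.lt_def] using hlt
      exact hi ⟨i, by omega⟩ rfl
    rintro (i | i) hi
    · exact key i fun j hj => hi ⟨Sum.inl j, by simp [e, hj]⟩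
    · exact key i fun j hj => hi ⟨Sum.inr j, by simp [e, hj]⟩
  have hp : ∀ Y Z : Matrix (Fin n ⊕ Fin n) (Fin k ⊕ Fin k) ℂ, Yᴴ * Y = 1 → Zᴴ * Z = 1 →
      ‖(Yᴴ * (diagonal (fun i => (b i : ℂ)) * K.map φ * diagonal (fun i => (b i : ℂ))) * Z).det‖
        ≤ ∏ j, g (e j) := by
    intro Y Z hY hZ
    let V : Matrix (Fin n ⊕ Fin n) (Fin n ⊕ Fin n) ℝ := Rᵀ * Q
    let W : Matrix (Fin n ⊕ Fin n) (Fin n ⊕ Fin n) ℝ := J (Fin n) ℝ * V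
    have hR2 : R * Rᵀ = 1 := mul_eq_one_comm.mp hR
    have hV : Vᵀ * V = 1 := by
      calc Vᵀ * V = Qᵀ * (R * Rᵀ) * Q := by
            simp only [V, transpose_mul, transpose_transpose, Matrix.mul_assoc]
        _ = 1 := by rw [hR2, Matrix.mul_one, hQ]
    have hW : Wᵀ * W = 1 := by
      calc Wᵀ * W = Vᵀ * ((J (Fin n) ℝ)ᵀ * J (Fin n) ℝ) * V := by
            simp only [W, transpose_mul, Matrix.mul_assoc]
        _ = 1 := by rw [hJJ, Matrix.mul_one, hV]
    have hiso : ∀ (V : Matrix (Fin n ⊕ Fin n) (Fin n ⊕ Fin n) ℝ)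
        (Y : Matrix (Fin n ⊕ Fin n) (Fin k ⊕ Fin k) ℂ), Vᵀ * V = 1 → Yᴴ * Y = 1 →
        (V.map φ * Y)ᴴ * (V.map φ * Y) = 1 := by
      intro V Y hV hY
      rw [conjTranspose_mul, Matrix.mul_assoc, ← Matrix.mul_assoc _ _ Y, hφ, ← Matrix.map_mul, hV,
        Matrix.map_one _ (map_zero φ) (map_one φ), Matrix.one_mul, hY]
    have hmat : diagonal (fun i => (b i : ℂ)) * K.map φ * diagonal (fun i => (b i : ℂ)) =
        (V.map φ)ᴴ * diagonal (fun i => (g i : ℂ)) * W.map φ := by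
      have h1 : diagonal (fun i => (b i : ℂ)) = (diagonal (fun i => b i ^ (1 : ℝ))).map φ := by
        rw [← hdiag]; simp only [Real.rpow_one]
      have h2 : diagonal (fun i => (g i : ℂ)) = (doubleDiagonal (fun j => (d j)⁻¹)).map φ := by
        rw [doubleDiagonal, diagonal_map (map_zero φ)]; rfl
      rw [h1, h2, hφ]
      simp only [← Matrix.map_mul]
      rw [hBK, hRB]
      simp only [V, W, transpose_mul, transpose_transpose, Matrix.mul_assoc]
    have := norm_det_conjTranspose_mul_diagonal_mul_le (hiso V Y hV hY) (hiso W Z hW hZ) hg0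
      (inv_pos.mpr (hd l)) he hin hout
    rw [hmat]
    simpa only [conjTranspose_mul, Matrix.mul_assoc] using this
  -- The columns of `X` span the singular subspace of `A ^ (-t / 2) J A ^ (-t / 2)` that belongs
  -- to its `2 k` largest singular values, written in the eigenbasis `Q`.
  let X₀ : Matrix (Fin n ⊕ Fin n) (Fin n ⊕ Fin n) ℝ := Qᵀ * R'
  let X : Matrix (Fin n ⊕ Fin n) (Fin k ⊕ Fin k) ℝ := X₀.submatrix id e
  have hXG : ∀ G : Matrix (Fin n ⊕ Fin n) (Fin n ⊕ Fin n) ℝ,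
      Xᵀ * G * X = (X₀ᵀ * G * X₀).submatrix e e := fun G => by
    rw [submatrix_mul _ _ e id e Function.bijective_id,
      submatrix_mul _ _ e id id Function.bijective_id]
    rfl
  have hXX : (X.map φ)ᴴ * X.map φ = 1 := by
    have h1 : X₀ᵀ * 1 * X₀ = 1 := by
      calc X₀ᵀ * 1 * X₀ = R'ᵀ * ((Q * Qᵀ) * R') := by
            simp only [X₀, transpose_mul, transpose_transpose, Matrix.mul_assoc, Matrix.one_mul]
        _ = 1 := by rw [hQ', Matrix.one_mul, hR']
    have h2 := hXG 1
    rw [h1, Matrix.mul_one, submatrix_one _ he] at h2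
    rw [hφ, ← Matrix.map_mul, h2, Matrix.map_one _ (map_zero φ) (map_one φ)]
  have main := norm_det_diagonal_rpow_le hKu hb he hp hXX ht0 ht1
  have hdet : (Xᵀ * (diagonal (fun i => b i ^ t) * K * diagonal (fun i => b i ^ t)) * X).det =
      (∏ j : Fin k, (d' (Fin.castLE hk j))⁻¹) ^ 2 := by
    rw [hXG, hBK, hRB']
    have h1 : X₀ᵀ * (Qᵀ * (R' * (doubleDiagonal (fun j => (d' j)⁻¹) * J (Fin n) ℝ) * R'ᵀ) * Q) *
        X₀ = doubleDiagonal (fun j => (d' j)⁻¹) * J (Fin n) ℝ := by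
      calc _ = R'ᵀ * ((Q * Qᵀ) * R') * (doubleDiagonal (fun j => (d' j)⁻¹) * J (Fin n) ℝ) *
            (R'ᵀ * ((Q * Qᵀ) * R')) := by
            simp only [X₀, transpose_mul, transpose_transpose, Matrix.mul_assoc]
        _ = _ := by rw [hQ', Matrix.one_mul, hR', Matrix.one_mul, Matrix.mul_one]
    rw [h1, doubleDiagonal_mul_J_submatrix, det_doubleDiagonal_mul_J]
  rw [hφ, hdiag, ← Matrix.map_mul, ← Matrix.map_mul, ← Matrix.map_mul, ← Matrix.map_mul,
    ← RingHom.mapMatrix_apply, ← RingHom.map_det, hdet, Fintype.prod_sum_type] at main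
  simp only [e, g, Sum.map_inl, Sum.map_inr, Sum.elim_inl, Sum.elim_inr, φ,
    Complex.ofRealHom_eq_coe, Complex.norm_real, ← sq, norm_pow, Real.norm_eq_abs,
    Finset.prod_inv_distrib, sq_abs] at main
  have hP : 0 < ∏ j : Fin k, d (Fin.castLE hk j) := Finset.prod_pos fun j _ => hd _
  have hP' : 0 < ∏ j : Fin k, d' (Fin.castLE hk j) := Finset.prod_pos fun j _ => h'.2.1 _
  rw [inv_pow, inv_pow, Real.inv_rpow (sq_nonneg _), inv_le_inv₀ (by positivity) (by positivity),
    ← Real.rpow_natCast, ← Real.rpow_natCast, ← Real.rpow_mul hP.le, mul_comm _ t,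
    Real.rpow_mul hP.le] at main
  rw [Real.finsetProd_rpow _ _ fun j _ => (hd _).le]
  exact (Real.rpow_le_rpow_iff (by positivity) hP'.le (by norm_num)).mp main

/-- Comparing the two spectra through `prod_rpow_le` at `t = 1` gives uniqueness. -/
theorem IsSymplecticSpectrum.unique {A : Matrix (Fin n ⊕ Fin n) (Fin n ⊕ Fin n) ℝ}
    (hA : A.PosDef) {d d' : Fin n → ℝ} (h : IsSymplecticSpectrum A d)
    (h' : IsSymplecticSpectrum A d') : d = d' := by
  have hA1 : A ^ (1 : ℝ) = A := CFC.rpow_one A hA.posSemidef.nonneg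
  have hle : ∀ {d d' : Fin n → ℝ}, IsSymplecticSpectrum A d → IsSymplecticSpectrum A d' →
      ∀ {k : ℕ} (hk : k ≤ n),
        ∏ j : Fin k, d (Fin.castLE hk j) ≤ ∏ j : Fin k, d' (Fin.castLE hk j) := by
    intro d d' h h' k hk
    simpa using h.prod_rpow_le hA zero_le_one le_rfl (hA1.symm ▸ h') hk
  have heq : ∀ {k : ℕ} (hk : k ≤ n),
      ∏ j : Fin k, d (Fin.castLE hk j) = ∏ j : Fin k, d' (Fin.castLE hk j) := fun hk =>
    le_antisymm (hle h h' hk) (hle h' h hk)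
  ext j
  have h1 := heq (k := j + 1) j.2
  rw [Fin.prod_univ_castSucc, Fin.prod_univ_castSucc] at h1
  have h2 := heq j.2.le
  have h3 : 0 < ∏ i : Fin j, d' (Fin.castLE j.2.le i) := Finset.prod_pos fun i _ => h'.2.1 _
  change (∏ i : Fin j, d (Fin.castLE j.2.le i)) * d j =
    (∏ i : Fin j, d' (Fin.castLE j.2.le i)) * d' j at h1
  rw [h2] at h1
  exact mul_left_cancel₀ h3.ne' h1

end SymplecticSpectrum

/-! ### The normal form of a skew-symmetric map -/

section SkewNormalForm

open scoped InnerProductSpace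
open Module

variable {E : Type*} [NormedAddCommGroup E] [InnerProductSpace ℝ E]

theorem LinearMap.inner_self_eq_zero_of_skew {S : E →ₗ[ℝ] E}
    (hS : ∀ x y, ⟪S x, y⟫_ℝ = -⟪x, S y⟫_ℝ) (x : E) : ⟪S x, x⟫_ℝ = 0 := by
  have h1 := hS x x
  rw [real_inner_comm] at h1
  rw [real_inner_comm]
  linarith

/-- An injective skew-symmetric map `S` has an orthonormal pair spanning an `S`-invariant plane,
found from an eigenvector of the symmetric map `S ∘ S`. -/
theorem LinearMap.exists_invariant_pair_of_skew [FiniteDimensional ℝ E] [Nontrivial E]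
    {S : E →ₗ[ℝ] E} (hS : ∀ x y, ⟪S x, y⟫_ℝ = -⟪x, S y⟫_ℝ) (hinj : Function.Injective S) :
    ∃ (v w : E) (c : ℝ), 0 < c ∧ ‖v‖ = 1 ∧ ‖w‖ = 1 ∧ ⟪v, w⟫_ℝ = 0 ∧ S v = c • w ∧
      S w = -(c • v) := by
  have hT : (S ∘ₗ S).IsSymmetric := fun x y => by
    simp only [LinearMap.comp_apply]; rw [hS, hS, neg_neg]
  obtain ⟨μ, hμ⟩ : ∃ μ : ℝ, End.HasEigenvalue (S ∘ₗ S) μ :=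
    ⟨_, hT.hasEigenvalue_iSup_of_finiteDimensional⟩
  obtain ⟨u, hu⟩ := hμ.exists_hasEigenvector
  have hu0 : ‖u‖ ≠ 0 := norm_ne_zero_iff.mpr hu.2
  let v : E := ‖u‖⁻¹ • u
  have hv : ‖v‖ = 1 := by simp [v, norm_smul, inv_mul_cancel₀ hu0]
  have hSSv : S (S v) = μ • v := by
    have h1 : S (S u) = μ • u := hu.apply_eq_smul
    simp only [v, map_smul, h1, smul_comm μ]
  have hv0 : v ≠ 0 := fun h => by simp [h] at hv
  have hSv0 : S v ≠ 0 := fun h => hv0 (hinj (by rw [h, map_zero]))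
  let c : ℝ := ‖S v‖
  have hc : 0 < c := norm_pos_iff.mpr hSv0
  have hμc : μ = -(c * c) := by
    have h1 := hS (S v) v
    rw [hSSv, real_inner_smul_left, real_inner_self_eq_norm_mul_norm,
      real_inner_self_eq_norm_mul_norm, hv] at h1
    simpa using h1
  refine ⟨v, c⁻¹ • S v, c, hc, hv, ?_, ?_, ?_, ?_⟩
  · rw [norm_smul, norm_inv, Real.norm_of_nonneg hc.le]; exact inv_mul_cancel₀ hc.ne'
  · rw [real_inner_smul_right, real_inner_comm, LinearMap.inner_self_eq_zero_of_skew hS, mul_zero]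
  · rw [smul_smul, mul_inv_cancel₀ hc.ne', one_smul]
  · rw [map_smul, hSSv, smul_smul, hμc, ← neg_smul]
    congr 1; field_simp

/-- By induction: split off an invariant plane and pass to its orthogonal complement. -/
theorem LinearMap.exists_skew_normal_form (n : ℕ) : ∀ {E : Type*} [NormedAddCommGroup E]
    [InnerProductSpace ℝ E] [FiniteDimensional ℝ E] (S : E →ₗ[ℝ] E)
    (_ : ∀ x y, ⟪S x, y⟫_ℝ = -⟪x, S y⟫_ℝ) (_ : Function.Injective S) (_ : finrank ℝ E = 2 * n),
    ∃ (e f : Fin n → E) (c : Fin n → ℝ), (∀ j, 0 < c j) ∧ Orthonormal ℝ (Sum.elim e f) ∧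
      ∀ j, S (e j) = c j • f j ∧ S (f j) = -(c j • e j) := by
  induction n with
  | zero =>
    intro E _ _ _ S _ _ _
    exact ⟨Fin.elim0, Fin.elim0, Fin.elim0, fun j => j.elim0,
      ⟨fun i => by rcases i with i | i <;> exact i.elim0,
        fun i => by rcases i with i | i <;> exact i.elim0⟩, fun j => j.elim0⟩
  | succ n ih =>
    intro E _ _ _ S hS hinj hdim
    have : Nontrivial E := nontrivial_of_finrank_pos (R := ℝ) (by omega)
    obtain ⟨v, w, c, hc, hv, hw, hvw, hSv, hSw⟩ := S.exists_invariant_pair_of_skew hS hinj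
    have hon : Orthonormal ℝ ![v, w] := by
      rw [orthonormal_iff_ite]
      have hwv : ⟪w, v⟫_ℝ = 0 := by rw [real_inner_comm, hvw]
      intro i j
      fin_cases i <;> fin_cases j <;> simp [hv, hw, hvw, hwv]
    -- The orthogonal complement of the plane is invariant under `S`.
    let K : Submodule ℝ E := (Submodule.span ℝ (Set.range ![v, w]))ᗮ
    have hK : finrank ℝ K = 2 * n := by
      have h1 := Submodule.finrank_add_finrank_orthogonal (Submodule.span ℝ (Set.range ![v, w]))
      rw [finrank_span_eq_card hon.linearIndependent, Fintype.card_fin] at h1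
      change 2 + finrank ℝ K = _ at h1
      omega
    have hmem : ∀ x, x ∈ K ↔ ⟪v, x⟫_ℝ = 0 ∧ ⟪w, x⟫_ℝ = 0 := by
      intro x
      have hle : x ∈ K ↔ Submodule.span ℝ (Set.range ![v, w]) ≤ (ℝ ∙ x)ᗮ := by
        rw [Submodule.mem_orthogonal]
        exact ⟨fun h u hu => Submodule.mem_orthogonal_singleton_iff_inner_left.mpr (h u hu),
          fun h u hu => Submodule.mem_orthogonal_singleton_iff_inner_left.mp (h hu)⟩
      rw [hle, Submodule.span_le]
      simp [Set.insert_subset_iff, Submodule.mem_orthogonal_singleton_iff_inner_left, and_comm]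
    have hSK : ∀ x ∈ K, S x ∈ K := by
      intro x hx
      rw [hmem] at hx ⊢
      constructor
      · have := hS v x
        rw [hSv, real_inner_smul_left, hx.2, mul_zero] at this
        linarith
      · have := hS w x
        rw [hSw, inner_neg_left, real_inner_smul_left, hx.1, mul_zero] at this
        linarith
    obtain ⟨e, f, b, hb, ho, hef⟩ := ih (S.restrict hSK) (fun x y => hS x y)
      (fun x y h => Subtype.ext (hinj (congrArg Subtype.val h))) hK
    have hoE : Orthonormal ℝ (fun i => ((Sum.elim e f i : K) : E)) :=
      ho.comp_linearIsometry K.subtypeₗᵢ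
    rw [orthonormal_iff_ite] at hoE
    have hve : ∀ x : K, ⟪v, (x : E)⟫_ℝ = 0 := fun x => ((hmem x).mp x.2).1
    have hwe : ∀ x : K, ⟪w, (x : E)⟫_ℝ = 0 := fun x => ((hmem x).mp x.2).2
    have hev : ∀ x : K, ⟪(x : E), v⟫_ℝ = 0 := fun x => by rw [real_inner_comm, hve]
    have hew : ∀ x : K, ⟪(x : E), w⟫_ℝ = 0 := fun x => by rw [real_inner_comm, hwe]
    have hwv : ⟪w, v⟫_ℝ = 0 := by rw [real_inner_comm, hvw]
    refine ⟨Fin.cons v fun j => (e j : E), Fin.cons w fun j => (f j : E), Fin.cons c b, ?_, ?_, ?_⟩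
    · intro j; refine Fin.cases ?_ (fun j => ?_) j
      · exact hc
      · exact hb j
    · rw [orthonormal_iff_ite]
      have hee : ∀ i j, ⟪(e i : E), (e j : E)⟫_ℝ = if i = j then 1 else 0 := fun i j => by
        simpa using hoE (Sum.inl i) (Sum.inl j)
      have hff : ∀ i j, ⟪(f i : E), (f j : E)⟫_ℝ = if i = j then 1 else 0 := fun i j => by
        simpa using hoE (Sum.inr i) (Sum.inr j)
      have hef : ∀ i j, ⟪(e i : E), (f j : E)⟫_ℝ = 0 := fun i j => by
        simpa using hoE (Sum.inl i) (Sum.inr j)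
      have hfe : ∀ i j, ⟪(f i : E), (e j : E)⟫_ℝ = 0 := fun i j => by
        simpa using hoE (Sum.inr i) (Sum.inl j)
      rintro (i | i) (j | j) <;> refine Fin.cases ?_ (fun i => ?_) i <;>
        refine Fin.cases ?_ (fun j => ?_) j <;>
        simp [hve, hwe, hev, hew, hv, hw, hvw, hwv, hee, hff, hef, hfe, Fin.succ_ne_zero,
          (Fin.succ_ne_zero _).symm]
    · intro j; refine Fin.cases ?_ (fun j => ?_) j
      · exact ⟨hSv, hSw⟩
      · exact ⟨congrArg Subtype.val (hef j).1, congrArg Subtype.val (hef j).2⟩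

end SkewNormalForm

/-! ### Williamson's theorem -/

section Williamson

open Matrix

variable {n : ℕ}

/-- The matrix form of `LinearMap.exists_skew_normal_form`, with the `c j` in decreasing order, so
that the symplectic eigenvalues `(c j)⁻¹` increase. -/
theorem Matrix.exists_orthogonal_skew_normal_form {S : Matrix (Fin n ⊕ Fin n) (Fin n ⊕ Fin n) ℝ}
    (hS : Sᵀ = -S) (hdet : IsUnit S.det) :
    ∃ (R : Matrix (Fin n ⊕ Fin n) (Fin n ⊕ Fin n) ℝ) (c : Fin n → ℝ), (∀ j, 0 < c j) ∧
      Antitone c ∧ Rᵀ * R = 1 ∧ Rᵀ * S * R = doubleDiagonal c * J (Fin n) ℝ := by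
  let T : EuclideanSpace ℝ (Fin n ⊕ Fin n) →ₗ[ℝ] EuclideanSpace ℝ (Fin n ⊕ Fin n) :=
    toEuclideanLin S
  have hT : ∀ x y, inner ℝ (T x) y = -inner ℝ x (T y) := by
    intro x y
    simp only [T, EuclideanSpace.inner_eq_star_dotProduct, star_trivial, toLpLin_apply]
    rw [dotProduct_mulVec, ← mulVec_transpose, hS, neg_mulVec, neg_dotProduct]
  have hTinj : Function.Injective T := by
    intro x y h
    have h1 : S *ᵥ x.ofLp = S *ᵥ y.ofLp := by
      simpa [T, toLpLin_apply] using h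
    exact WithLp.ofLp_injective 2 (mulVec_injective_of_isUnit
      ((isUnit_iff_isUnit_det S).mpr hdet) h1)
  obtain ⟨e, f, c, hc, ho, hef⟩ := T.exists_skew_normal_form n hT hTinj (by simp; ring)
  let σ : Equiv.Perm (Fin n) := Tuple.sort fun j => -c j
  have hσ : Antitone (c ∘ σ) := fun i j hij => by
    have := Tuple.monotone_sort (fun j => -c j) hij
    simpa using this
  let F : Fin n ⊕ Fin n → EuclideanSpace ℝ (Fin n ⊕ Fin n) := Sum.elim (e ∘ σ) (f ∘ σ)
  have hF : Orthonormal ℝ F := by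
    have := ho.comp (Sum.map σ σ) (σ.injective.sumMap σ.injective)
    rwa [Sum.elim_comp_map] at this
  let R : Matrix (Fin n ⊕ Fin n) (Fin n ⊕ Fin n) ℝ := of fun i j => F j i
  have hR : Rᵀ * R = 1 := by
    ext i j
    rw [one_apply, ← orthonormal_iff_ite.mp hF i j]
    simp [R, Matrix.mul_apply, PiLp.inner_apply, mul_comm]
  have hSR : S * R = R * (doubleDiagonal (c ∘ σ) * J (Fin n) ℝ) := by
    ext i j
    have h1 : (S * R) i j = T (F j) i := by
      simp [T, R, toLpLin_apply, Matrix.mul_apply, mulVec, dotProduct]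
    rw [h1, doubleDiagonal_mul_J, ← Matrix.mul_assoc, doubleDiagonal, mul_diagonal, J,
      Matrix.mul_apply, Fintype.sum_sum_type]
    rcases j with j | j
    · have h2 : T (F (Sum.inl j)) = c (σ j) • f (σ j) := (hef (σ j)).1
      rw [h2]
      simp [R, F, one_apply, mul_comm]
    · have h2 : T (F (Sum.inr j)) = -(c (σ j) • e (σ j)) := (hef (σ j)).2
      rw [h2]
      simp [R, F, one_apply, mul_comm]
  refine ⟨R, c ∘ σ, fun j => hc _, hσ, hR, ?_⟩
  rw [Matrix.mul_assoc, hSR, ← Matrix.mul_assoc, hR, Matrix.one_mul]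

/-- **Williamson's theorem**. With `B = A ^ (-1/2)` and `R` bringing `B J B` to normal form, the
symplectic matrix is `B R diag (c, c) ^ (-1/2)`. -/
theorem Matrix.PosDef.exists_isSymplecticSpectrum {A : Matrix (Fin n ⊕ Fin n) (Fin n ⊕ Fin n) ℝ}
    (hA : A.PosDef) : ∃ d, IsSymplecticSpectrum A d := by
  have hBdef := hA.rpow (-(1 / 2))
  set B := A ^ (-(1 / 2) : ℝ) with hB
  have hBT : Bᵀ = B := by simpa using hBdef.1.eq
  have hBA : B * A * B = 1 := by
    have hA0 : IsUnit A := hA.isUnit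
    have h1 : B * A ^ (1 : ℝ) * B = A ^ (0 : ℝ) := by
      rw [hB, ← CFC.rpow_add hA0, ← CFC.rpow_add hA0]; norm_num
    rwa [CFC.rpow_one A hA.posSemidef.nonneg, CFC.rpow_zero A hA.posSemidef.nonneg] at h1
  have hS : (B * J (Fin n) ℝ * B)ᵀ = -(B * J (Fin n) ℝ * B) := by
    simp [transpose_mul, hBT, Matrix.mul_assoc, J_transpose]
  have hdet : IsUnit (B * J (Fin n) ℝ * B).det := by
    have hBd : IsUnit B.det := (isUnit_iff_isUnit_det B).mp hBdef.isUnit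
    rw [det_mul, det_mul]
    exact (hBd.mul (isUnit_det_J _ _)).mul hBd
  obtain ⟨R, c, hc, hanti, hR, hRS⟩ := exists_orthogonal_skew_normal_form hS hdet
  let r : Fin n → ℝ := fun j => (√(c j))⁻¹
  have hrr : ∀ j, r j * r j = (c j)⁻¹ := fun j => by
    simp only [r]; rw [← mul_inv, Real.mul_self_sqrt (hc j).le]
  refine ⟨fun j => (c j)⁻¹, fun i j hij => inv_anti₀ (hc j) (hanti hij),
    fun j => inv_pos.mpr (hc j), B * R * doubleDiagonal r, SymplecticGroup.mem_iff'.mpr ?_, ?_⟩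
  · calc _ = doubleDiagonal r * (Rᵀ * (B * J (Fin n) ℝ * B) * R) * doubleDiagonal r := by
          simp only [transpose_mul, transpose_doubleDiagonal, hBT, Matrix.mul_assoc]
      _ = J (Fin n) ℝ := by
        rw [hRS, Matrix.mul_assoc, Matrix.mul_assoc, ← doubleDiagonal_mul_J, ← Matrix.mul_assoc,
          ← Matrix.mul_assoc, doubleDiagonal_mul, doubleDiagonal_mul]
        have : (fun j => r j * c j * r j) = fun _ => (1 : ℝ) := by
          ext j; rw [mul_right_comm, hrr, inv_mul_cancel₀ (hc j).ne']
        rw [this, doubleDiagonal_one, Matrix.one_mul]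
  · rw [fromBlocks_diagonal_eq]
    calc _ = doubleDiagonal r * (Rᵀ * (B * A * B) * R) * doubleDiagonal r := by
          simp only [transpose_mul, transpose_doubleDiagonal, hBT, Matrix.mul_assoc]
      _ = _ := by
        rw [hBA, Matrix.mul_one, hR, Matrix.mul_one, doubleDiagonal_mul]
        simp only [hrr]

theorem Matrix.PosDef.existsUnique_isSymplecticSpectrum
    {A : Matrix (Fin n ⊕ Fin n) (Fin n ⊕ Fin n) ℝ} (hA : A.PosDef) :
    ∃! d, IsSymplecticSpectrum A d :=
  hA.exists_isSymplecticSpectrum.elim fun d hd => ⟨d, hd, fun _ hd' => hd'.unique hA hd⟩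

theorem Matrix.PosDef.isSymplecticSpectrum_symplecticEigenvalues
    {A : Matrix (Fin n ⊕ Fin n) (Fin n ⊕ Fin n) ℝ} (hA : A.PosDef) :
    IsSymplecticSpectrum A (symplecticEigenvalues A) :=
  Classical.epsilon_spec hA.exists_isSymplecticSpectrum

end Williamson

/-! ### The inequalities for symplectic eigenvalues -/

/-- Here `A ^ t` is the real power given by the continuous functional calculus. The first two
clauses say that the symplectic eigenvalues of `A` and of `A ^ t` exist and are unique. -/
theorem corollary2 (n : ℕ) (A : Matrix (Fin n ⊕ Fin n) (Fin n ⊕ Fin n) ℝ) (hA : A.PosDef) :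
    (∃! d : Fin n → ℝ, IsSymplecticSpectrum A d) ∧
    (∀ t : ℝ, 0 ≤ t → ∃! d : Fin n → ℝ, IsSymplecticSpectrum (A ^ t) d) ∧
    (∀ t : ℝ, 0 ≤ t → t ≤ 1 → ∀ (k : ℕ) (_ : 1 ≤ k) (hk : k ≤ n),
      ∏ j : Fin k, symplecticEigenvalues (A ^ t) (Fin.castLE hk j) ≥
        ∏ j : Fin k, symplecticEigenvalues A (Fin.castLE hk j) ^ t) ∧
    (∀ t : ℝ, 1 ≤ t → ∀ (k : ℕ) (_ : 1 ≤ k) (hk : k ≤ n),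
      ∏ j : Fin k, symplecticEigenvalues (A ^ t) (Fin.castLE hk j) ≤
        ∏ j : Fin k, symplecticEigenvalues A (Fin.castLE hk j) ^ t) := by
  have hspec := fun t : ℝ => (hA.rpow t).isSymplecticSpectrum_symplecticEigenvalues
  have hspecA := hA.isSymplecticSpectrum_symplecticEigenvalues
  refine ⟨hA.existsUnique_isSymplecticSpectrum,
    fun t _ => (hA.rpow t).existsUnique_isSymplecticSpectrum,
    fun t ht0 ht1 k _ hk => hspecA.prod_rpow_le hA ht0 ht1 (hspec t) hk, fun t ht k _ hk => ?_⟩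
  have ht0 : 0 < t := one_pos.trans_le ht
  -- Apply the case of exponent `t⁻¹ ≤ 1` to `A ^ t`, whose `t⁻¹`-th power is `A`.
  have hroot : (A ^ t) ^ t⁻¹ = A :=
    CFC.rpow_rpow_inv A t ht0.ne' (Matrix.isStrictlyPositive_iff_posDef.mpr hA)
  have h := (hspec t).prod_rpow_le (d' := symplecticEigenvalues A) (hA.rpow t)
    (inv_nonneg.mpr ht0.le) (inv_le_one_of_one_le₀ ht) (by rw [hroot]; exact hspecA) hk
  have hpos : ∀ j, 0 ≤ symplecticEigenvalues A j := fun j => (hspecA.2.1 j).le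
  have hpos' : ∀ j, 0 ≤ symplecticEigenvalues (A ^ t) j := fun j => ((hspec t).2.1 j).le
  rw [Real.finsetProd_rpow _ _ fun j _ => hpos' _] at h
  rw [Real.finsetProd_rpow _ _ fun j _ => hpos _]
  exact (Real.rpow_inv_le_iff_of_pos (Finset.prod_nonneg fun j _ => hpos' _)
    (Finset.prod_nonneg fun j _ => hpos _) ht0).mp h
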